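/- Let $d\ge 1$ and $k\ge 1$ be integers and let $\alpha>d$. Put $$C_k=\frac{s_{d-1}}{(k+2)!\,\bigl(\alpha(k+2)-d\bigr)},$$ where $s_{d-1}$ is the surface area of the unit sphere of $\mathbb R^d$. For $t\ge 0$ and $x_1,\dots,x_{k+2}\in\mathbb R^d$, with $B(x;t)$ the closed Euclidean ball of radius $t$ about $x$, let $$h_t^+(x_1,\dots,x_{k+2})=\mathbf 1\Bigl\{\bigcap_{j\ne j_0}B(x_j;t)\neq\emptyset\ \text{for all } j_0\in\{1,\dots,k+2\}\Bigr\},\qquad h_t^-(x_1,\dots,x_{k+2})=\mathbf 1\Bigl\{\bigcap_{j=1}^{k+2}B(x_j;t)\neq\emptyset\Bigr\},$$ and $h^{\pm}=h_1^{\pm}$. Let $M_k$ be a Poisson random measure on $(\mathbb R^d)^{k+1}$ with intensity measure $C_k\lambda_k$, where $\lambda_k$ is Lebesgue measure, and define $$V_k^{\pm}(t)=\int_{(\mathbb R^d)^{k+1}}h_t^{\pm}(0,\mathbf y)\,M_k(d\mathbf y),\qquad t\ge 0.$$ Then, for each of the two signs, $\int_{(\mathbb R^d)^{k+1}}h^{\pm}(0,\mathbf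 y)\,d\mathbf y<\infty$; almost surely the integrals defining $V_k^{\pm}(t)$ are finite for all $t\ge 0$; and the process $V_k^{\pm}$ is represented in law as $$\bigl(V_k^{\pm}(t),\,t\ge 0\bigr)\stackrel{d}{=}\bigl(N_k^{\pm}(t^{d(k+1)}),\,t\ge 0\bigr),$$ where $N_k^{\pm}$ is a Poisson process with intensity $C_k\int_{(\mathbb R^d)^{k+1}}h^{\pm}(0,\mathbf y)\,d\mathbf y$. (Such a Poisson process can be defined on the probability space of $M_k$, and the equality in law holds for every such process on any probability space.) -/

import Mathlib

open MeasureTheory ProbabilityTheory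
open scoped NNReal ENNReal Nat

noncomputable section

namespace CechPoisson

/-- `M` is a Poisson random measure with intensity measure `Λ` on the probability space `(Ω, P)`:
it is a random measure, `M(A)` has the Poisson law with mean `Λ(A)` for every measurable `A` with
`Λ(A) < ∞`, and `M(A₁), …, M(Aₘ)` are independent for pairwise disjoint measurable
`A₁, …, Aₘ`. -/
structure IsPoissonRandomMeasure {Ω E : Type*} [MeasurableSpace Ω] [MeasurableSpace E]
    (M : Ω → Measure E) (Λ : Measure E) (P : Measure Ω) : Prop where
  measurable : Measurable M
  hasLaw : ∀ A : Set E, MeasurableSet A → Λ A < ∞ →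
    HasLaw (fun ω ↦ M ω A)
      ((poissonMeasure (Λ A).toNNReal).map (fun n : ℕ ↦ (n : ℝ≥0∞))) P
  indep : ∀ (m : ℕ) (A : Fin m → Set E), (∀ i, MeasurableSet (A i)) →
    Pairwise (fun i j ↦ Disjoint (A i) (A j)) →
    iIndepFun (fun (i : Fin m) (ω : Ω) ↦ M ω (A i)) P

/-- `N` is a (homogeneous) Poisson process with intensity `r` on `(Ω, P)`: a counting process
started at `0` whose paths are almost surely non-decreasing and right-continuous (hence càdlàg),
with independent increments, and with `N(t) - N(s)` Poisson of mean `r (t - s)` for `s ≤ t`. -/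
structure IsPoissonProcess {Ω : Type*} [MeasurableSpace Ω]
    (N : ℝ≥0 → Ω → ℕ) (r : ℝ≥0) (P : Measure Ω) : Prop where
  measurable : ∀ t, Measurable (N t)
  zero : ∀ᵐ ω ∂P, N 0 ω = 0
  mono : ∀ᵐ ω ∂P, Monotone (fun t ↦ N t ω)
  rightCont : ∀ᵐ ω ∂P, ∀ t, ContinuousWithinAt (fun s ↦ N s ω) (Set.Ici t) t
  indepIncrements : HasIndepIncrements (fun t ω ↦ (N t ω : ℝ)) P
  hasLaw : ∀ s t : ℝ≥0, s ≤ t →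
    HasLaw (fun ω ↦ (N t ω : ℝ) - (N s ω : ℝ))
      ((poissonMeasure (r * (t - s))).map (fun n : ℕ ↦ (n : ℝ))) P

/-- The two signs in the superscript `±`. -/
inductive PM : Type
  | plus
  | minus

/-- The set of configurations `(x₁, …, x_{k+2})` of which `h_t^+`, respectively `h_t^-`, is the
indicator: for `+`, for each `j₀` the closed balls `B(x_j; t)`, `j ≠ j₀`, have a common point;
for `-`, all the closed balls `B(x_j; t)` have a common point. -/
def hSet (d k : ℕ) : PM → ℝ → Set (Fin (k + 2) → EuclideanSpace ℝ (Fin d))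
  | PM.plus, t => {x | ∀ j₀ : Fin (k + 2),
      (⋂ (j : Fin (k + 2)) (_ : j ≠ j₀), Metric.closedBall (x j) t).Nonempty}
  | PM.minus, t => {x | (⋂ j : Fin (k + 2), Metric.closedBall (x j) t).Nonempty}

/-- The indicator functions `h_t^±(x₁, …, x_{k+2})`. -/
def h (d k : ℕ) (s : PM) (t : ℝ) (x : Fin (k + 2) → EuclideanSpace ℝ (Fin d)) : ℝ :=
  (hSet d k s t).indicator (fun _ ↦ 1) x

/-- The function `𝐲 ↦ h_t^±(0, 𝐲)` on `(ℝ^d)^{k+1}`. -/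
def h0 (d k : ℕ) (s : PM) (t : ℝ) (y : Fin (k + 1) → EuclideanSpace ℝ (Fin d)) : ℝ :=
  h d k s t (Matrix.vecCons 0 y)

/-- `C_k = s_{d-1} / ((k+2)! (α (k+2) - d))`, with `s_{d-1}` the surface area of the unit sphere
of `ℝ^d`. -/
def C (d k : ℕ) (α : ℝ) : ℝ :=
  (volume : Measure (EuclideanSpace ℝ (Fin d))).toSphere.real Set.univ /
    (((k + 2)! : ℝ) * (α * ((k : ℝ) + 2) - (d : ℝ)))

/-- The process `V_k^±(t) = ∫ h_t^±(0, 𝐲) M(d𝐲)`. -/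
def V {Ω : Type*} (d k : ℕ) (s : PM)
    (M : Ω → Measure (Fin (k + 1) → EuclideanSpace ℝ (Fin d))) (t : ℝ≥0) (ω : Ω) : ℝ :=
  ∫ y, h0 d k s (t : ℝ) y ∂(M ω)

/-- The intensity `C_k ∫ h_1^±(0, 𝐲) d𝐲`. -/
def intensity (d k : ℕ) (α : ℝ) (s : PM) : ℝ :=
  C d k α * ∫ y, h0 d k s 1 y

end CechPoisson

end

namespace CechPoisson

/-! `V(t)` is the `M`-mass of `pinnedSet d k s t`, the configurations whose balls of radius `t` meet
as required when one centre is pinned at `0`. These sets are compact, increase right-continuously in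
`t`, and are dilates `t • pinnedSet d k s 1`, so their intensity is proportional to `t ^ (d * (k +
1))` (`smul_volume_pinnedSet`). In the clock `u = t ^ (d * (k + 1))` it is linear, and a Poisson
random measure on such a family counts a Poisson process: disjoint shells give independent Poisson
increments (`IsPoissonRandomMeasure.isPoissonProcess`). Increments determine the finite-dimensional
laws, hence the law of the whole process, so any other Poisson process of that intensity may be
substituted (`IsPoissonProcess.identDistrib`). -/

/-- A finite set of times is enumerated by a monotone sequence started at `0`. -/
lemma exists_monotone_seq_enum (I : Finset ℝ≥0) :
    ∃ (t : ℕ → ℝ≥0) (e : I → ℕ), Monotone t ∧ t 0 = 0 ∧ ∀ x : I, t (e x) = x := by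
  obtain rfl | hI := I.eq_empty_or_nonempty
  · exact ⟨fun _ ↦ 0, fun _ ↦ 0, monotone_const, rfl, fun x ↦ absurd x.2 (Finset.notMem_empty _)⟩
  have hpos : 0 < I.card := Finset.card_pos.2 hI
  let f := I.orderIsoOfFin rfl
  -- Capping the index keeps the sequence constant after the last time; the shift by one below
  -- reserves index `0` for time `0`.
  let g : ℕ → Fin I.card := fun j ↦ ⟨min j (I.card - 1), by omega⟩
  refine ⟨fun j ↦ Nat.casesOn j 0 (fun j ↦ (f (g j) : ℝ≥0)), fun x ↦ (f.symm x : ℕ) + 1, ?_, rfl, ?_⟩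
  · refine monotone_nat_of_le_succ fun j ↦ ?_
    cases j with
    | zero => exact zero_le
    | succ j =>
      have : g j ≤ g (j + 1) := by
        simp only [g, Fin.mk_le_mk]; omega
      exact f.monotone this
  · intro x
    have : g (f.symm x : ℕ) = f.symm x := by
      ext
      have := (f.symm x).2
      simp only [g]; omega
    simp [this]

/-- Processes started at `0` with independent increments and the same laws of increments have the
same law. -/
lemma identDistrib_of_hasIndepIncrements {Ω Ω' : Type*} [MeasurableSpace Ω] [MeasurableSpace Ω']
    {P : Measure Ω} {P' : Measure Ω'} [IsProbabilityMeasure P] [IsProbabilityMeasure P']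
    {X : ℝ≥0 → Ω → ℝ} {Y : ℝ≥0 → Ω' → ℝ}
    (hX : ∀ t, Measurable (X t)) (hY : ∀ t, Measurable (Y t))
    (hX0 : ∀ᵐ ω ∂P, X 0 ω = 0) (hY0 : ∀ᵐ ω ∂P', Y 0 ω = 0)
    (hXi : HasIndepIncrements X P) (hYi : HasIndepIncrements Y P')
    (hlaw : ∀ s t, s ≤ t → P.map (fun ω ↦ X t ω - X s ω) = P'.map (fun ω ↦ Y t ω - Y s ω)) :
    IdentDistrib (fun ω t ↦ X t ω) (fun ω t ↦ Y t ω) P P' := by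
  have hXm : Measurable (fun ω t ↦ X t ω) := measurable_pi_lambda _ hX
  have hYm : Measurable (fun ω t ↦ Y t ω) := measurable_pi_lambda _ hY
  refine ⟨hXm.aemeasurable, hYm.aemeasurable, ?_⟩
  refine (isProjectiveLimit_map hXm.aemeasurable).unique (fun I ↦ ?_)
  rw [Measure.map_map (Finset.measurable_restrict _) hYm]
  obtain ⟨t, e, ht, ht0, hte⟩ := exists_monotone_seq_enum I
  obtain ⟨n, hn⟩ : ∃ n : ℕ, ∀ x : I, e x ≤ n :=
    ⟨Finset.univ.sup e, fun x ↦ Finset.le_sup (f := e) (Finset.mem_univ x)⟩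
  -- `Φ` recovers the values at the times of `I` from the increments by telescoping, so equality of
  -- the increment laws transfers to the marginals.
  let Φ : (Fin n → ℝ) → (I → ℝ) := fun v x ↦ ∑ i : Fin n, if (i : ℕ) < e x then v i else 0
  have hΦ : Measurable Φ := by
    refine measurable_pi_lambda _ fun x ↦ Finset.measurable_sum _ fun i _ ↦ ?_
    split_ifs <;> fun_prop
  have key (u : ℝ≥0 → ℝ) (hu : u 0 = 0) :
      I.restrict u = Φ (fun i : Fin n ↦ u (t (i + 1)) - u (t i)) := by
    funext x
    have h1 : ∑ i ∈ Finset.range n, (if i < e x then u (t (i + 1)) - u (t i) else 0)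
        = u x := by
      rw [← Finset.sum_filter]
      have : (Finset.range n).filter (fun i ↦ i < e x) = Finset.range (e x) := by
        ext i; have := hn x; simp only [Finset.mem_filter, Finset.mem_range]; omega
      rw [this, Finset.sum_range_sub (fun i ↦ u (t i)), hte, ht0, hu, sub_zero]
    rw [Finset.sum_range] at h1
    exact h1.symm
  have hXd (i : Fin n) : Measurable (fun ω ↦ X (t (i + 1)) ω - X (t i) ω) := (hX _).sub (hX _)
  have hYd (i : Fin n) : Measurable (fun ω ↦ Y (t (i + 1)) ω - Y (t i) ω) := (hY _).sub (hY _)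
  have hXW : P.map (fun ω (i : Fin n) ↦ X (t (i + 1)) ω - X (t i) ω)
      = P'.map (fun ω (i : Fin n) ↦ Y (t (i + 1)) ω - Y (t i) ω) := by
    have h1 := (hXi.nat ht).precomp (g := fun i : Fin n ↦ (i : ℕ)) Fin.val_injective
    have h2 := (hYi.nat ht).precomp (g := fun i : Fin n ↦ (i : ℕ)) Fin.val_injective
    rw [iIndepFun_iff_map_fun_eq_pi_map (fun i ↦ (hXd i).aemeasurable)] at h1
    rw [iIndepFun_iff_map_fun_eq_pi_map (fun i ↦ (hYd i).aemeasurable)] at h2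
    rw [h1, h2]
    congr 1
    funext i
    exact hlaw _ _ (ht (Nat.le_succ _))
  have e1 : P.map (fun ω ↦ I.restrict (X · ω))
      = (P.map (fun ω (i : Fin n) ↦ X (t (i + 1)) ω - X (t i) ω)).map Φ := by
    rw [Measure.map_map hΦ (measurable_pi_lambda _ hXd)]
    exact Measure.map_congr (hX0.mono fun ω h ↦ key (X · ω) h)
  have e2 : P'.map (I.restrict ∘ fun ω t ↦ Y t ω)
      = (P'.map (fun ω (i : Fin n) ↦ Y (t (i + 1)) ω - Y (t i) ω)).map Φ := by
    rw [Measure.map_map hΦ (measurable_pi_lambda _ hYd)]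
    exact Measure.map_congr (hY0.mono fun ω h ↦ key (Y · ω) h)
  exact e2.trans (hXW ▸ e1.symm)

/-- Poisson processes of the same intensity have the same law. -/
lemma IsPoissonProcess.identDistrib {Ω Ω' : Type*} [MeasurableSpace Ω] [MeasurableSpace Ω']
    {P : Measure Ω} {P' : Measure Ω'} [IsProbabilityMeasure P] [IsProbabilityMeasure P']
    {N : ℝ≥0 → Ω → ℕ} {N' : ℝ≥0 → Ω' → ℕ} {r : ℝ≥0}
    (hN : IsPoissonProcess N r P) (hN' : IsPoissonProcess N' r P') :
    IdentDistrib (fun ω t ↦ (N t ω : ℝ)) (fun ω t ↦ (N' t ω : ℝ)) P P' :=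
  identDistrib_of_hasIndepIncrements
    (fun t ↦ measurable_from_top.comp (hN.measurable t))
    (fun t ↦ measurable_from_top.comp (hN'.measurable t))
    (hN.zero.mono fun ω h ↦ by simp [h]) (hN'.zero.mono fun ω h ↦ by simp [h])
    hN.indepIncrements hN'.indepIncrements
    (fun s t hst ↦ by rw [(hN.hasLaw s t hst).map_eq, (hN'.hasLaw s t hst).map_eq])

/-! ### Poisson random measures along increasing families of sets -/

open Filter Topology in
/-- If a measure takes natural values on a dense set of members of a right-continuous increasing
family of sets, then it does so on the whole family, as a right-continuous function. -/
lemma exists_eventually_measure_eq_natCast {E : Type*} [MeasurableSpace E] {μ : Measure E}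
    {B : ℝ≥0 → Set E} (hBm : ∀ u, MeasurableSet (B u)) (hB : Monotone B)
    (hBr : ∀ u x, (∀ v, u < v → x ∈ B v) → x ∈ B u)
    {D : Set ℝ≥0} (hD : Dense D) (hμ : ∀ q ∈ D, ∃ n : ℕ, μ (B q) = n) (u : ℝ≥0) :
    ∃ n : ℕ, ∀ᶠ v in 𝓝[≥] u, μ (B v) = n := by
  obtain ⟨q, hq, hqD, hqt⟩ := hD.exists_seq_strictAnti_tendsto u
  choose c hc using fun n ↦ hμ (q n) (hqD n).2
  have hcanti : Antitone c := fun i j hij ↦ by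
    have := measure_mono (μ := μ) (hB (hq.antitone hij))
    rw [hc, hc] at this
    exact_mod_cast this
  -- A decreasing sequence of naturals is constant from an index where it attains its minimum.
  obtain ⟨i, hi⟩ : ∃ i, ∀ j, i ≤ j → c j = c i := by
    refine ⟨Function.argmin c, fun j hij ↦ le_antisymm (hcanti hij) (Function.argmin_le c j)⟩
  have hBu : B u = ⋂ j, B (q j) := by
    refine Set.Subset.antisymm (Set.subset_iInter fun j ↦ hB (hqD j).1.le) fun x hx ↦ ?_
    refine hBr u x fun v hv ↦ ?_
    obtain ⟨j, hj⟩ := (hqt.eventually (gt_mem_nhds hv)).exists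
    exact hB hj.le (Set.mem_iInter.1 hx j)
  have hlim : Tendsto (fun j ↦ μ (B (q j))) atTop (𝓝 (μ (B u))) := by
    rw [hBu]
    exact tendsto_measure_iInter_atTop (fun j ↦ (hBm _).nullMeasurableSet)
      (fun a b hab ↦ hB (hq.antitone hab)) ⟨0, by simp [hc]⟩
  have hval : μ (B u) = c i := by
    refine tendsto_nhds_unique hlim (tendsto_const_nhds.congr' ?_)
    filter_upwards [eventually_ge_atTop i] with j hj
    rw [hc, hi j hj]
  refine ⟨c i, ?_⟩
  -- On `[u, q i)` the mass is squeezed between its values at `u` and `q i`, both equal to `c i`.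
  filter_upwards [Ico_mem_nhdsGE (hqD i).1] with v hv
  refine le_antisymm ?_ ?_
  · rw [← hc]; exact measure_mono (hB hv.2.le)
  · rw [← hval]; exact measure_mono (hB hv.1)

section

variable {Ω E : Type*} [MeasurableSpace Ω] [MeasurableSpace E] {P : Measure Ω}
  {M : Ω → Measure E} {Λ : Measure E}

lemma IsPoissonRandomMeasure.measurable_apply (hM : IsPoissonRandomMeasure M Λ P)
    {A : Set E} (hA : MeasurableSet A) : Measurable (fun ω ↦ M ω A) :=
  (Measure.measurable_coe hA).comp hM.measurable

/-- A Poisson random measure is almost surely a natural number on a set of finite intensity. -/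
lemma IsPoissonRandomMeasure.ae_exists_natCast (hM : IsPoissonRandomMeasure M Λ P)
    {A : Set E} (hA : MeasurableSet A) (hΛ : Λ A < ∞) : ∀ᵐ ω ∂P, ∃ n : ℕ, M ω A = n := by
  have hR : MeasurableSet (Set.range (Nat.cast : ℕ → ℝ≥0∞)) := (Set.countable_range _).measurableSet
  have hp : MeasurableSet {x : ℝ≥0∞ | ∃ n : ℕ, x = n} := by
    convert hR using 1
    ext x; simp [eq_comm]
  rw [← ae_map_iff (p := fun x : ℝ≥0∞ ↦ ∃ n : ℕ, x = n) (hM.measurable_apply hA).aemeasurable hp,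
    (hM.hasLaw A hA hΛ).map_eq, ae_map_iff measurable_from_top.aemeasurable hp]
  exact ae_of_all _ fun n ↦ ⟨n, rfl⟩

lemma IsPoissonRandomMeasure.ae_eq_zero (hM : IsPoissonRandomMeasure M Λ P)
    {A : Set E} (hA : MeasurableSet A) (hΛ : Λ A = 0) : ∀ᵐ ω ∂P, M ω A = 0 := by
  have h := hM.hasLaw A hA (by simp [hΛ])
  have hp : MeasurableSet {x : ℝ≥0∞ | x = 0} := measurableSet_singleton 0
  rw [← ae_map_iff (p := fun x : ℝ≥0∞ ↦ x = 0) (hM.measurable_apply hA).aemeasurable hp,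
    h.map_eq, ae_map_iff measurable_from_top.aemeasurable hp, hΛ]
  have h1 : poissonMeasure 0 {0} = 1 := by simp [poissonMeasure_singleton]
  have h2 : poissonMeasure 0 {0}ᶜ = 0 := (prob_compl_eq_zero_iff (measurableSet_singleton 0)).2 h1
  refine measure_mono_null (fun n hn ↦ ?_) h2
  simpa using hn

lemma IsPoissonRandomMeasure.hasLaw_toReal (hM : IsPoissonRandomMeasure M Λ P)
    {A : Set E} (hA : MeasurableSet A) (hΛ : Λ A < ∞) :
    HasLaw (fun ω ↦ (M ω A).toReal)
      ((poissonMeasure (Λ A).toNNReal).map (fun n : ℕ ↦ (n : ℝ))) P := by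
  refine HasLaw.fun_comp (Y := ENNReal.toReal) ⟨ENNReal.measurable_toReal.aemeasurable, ?_⟩
    (hM.hasLaw A hA hΛ)
  rw [Measure.map_map ENNReal.measurable_toReal measurable_from_top]
  rfl

variable {B : ℝ≥0 → Set E} {r : ℝ≥0}

/-- Almost surely, all the values of a Poisson random measure on a right-continuous increasing
family of sets of finite intensity are natural numbers. -/
lemma IsPoissonRandomMeasure.ae_eventually_natCast (hM : IsPoissonRandomMeasure M Λ P)
    (hBm : ∀ u, MeasurableSet (B u)) (hB : Monotone B)
    (hBr : ∀ u x, (∀ v, u < v → x ∈ B v) → x ∈ B u) (hΛ : ∀ u, Λ (B u) < ∞) :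
    ∀ᵐ ω ∂P, ∀ u, ∃ n : ℕ, ∀ᶠ v in nhdsWithin u (Set.Ici u), M ω (B v) = n := by
  have h : ∀ᵐ ω ∂P, ∀ i, ∃ n : ℕ, M ω (B (TopologicalSpace.denseSeq ℝ≥0 i)) = n :=
    ae_all_iff.2 fun i ↦ hM.ae_exists_natCast (hBm _) (hΛ _)
  filter_upwards [h] with ω hω u
  refine exists_eventually_measure_eq_natCast hBm hB hBr
    (TopologicalSpace.denseRange_denseSeq ℝ≥0) ?_ u
  rintro _ ⟨i, rfl⟩
  exact hω i

/-- A Poisson random measure counts a Poisson process along a right-continuous increasing family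
of sets whose intensity grows linearly. -/
lemma IsPoissonRandomMeasure.isPoissonProcess (hM : IsPoissonRandomMeasure M Λ P)
    (hBm : ∀ u, MeasurableSet (B u)) (hB : Monotone B)
    (hBr : ∀ u x, (∀ v, u < v → x ∈ B v) → x ∈ B u) (hΛ : ∀ u, Λ (B u) = (r * u : ℝ≥0)) :
    IsPoissonProcess (fun u ω ↦ ⌊(M ω (B u)).toReal⌋₊) r P := by
  have hfin (u) : Λ (B u) < ∞ := by rw [hΛ]; exact ENNReal.coe_lt_top
  -- Off one null set, common to all `u`, masses are natural numbers, so `toReal` and the floor lose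
  -- nothing.
  have hev := hM.ae_eventually_natCast hBm hB hBr hfin
  have hnat : ∀ᵐ ω ∂P, ∀ u, ∃ n : ℕ, M ω (B u) = n := by
    filter_upwards [hev] with ω hω u
    obtain ⟨n, hn⟩ := hω u
    exact ⟨n, hn.self_of_nhdsWithin Set.self_mem_Ici⟩
  have hsub (s t : ℝ≥0) (hst : s ≤ t) : ∀ᵐ ω ∂P, (M ω (B t \ B s)).toReal =
      (⌊(M ω (B t)).toReal⌋₊ : ℝ) - (⌊(M ω (B s)).toReal⌋₊ : ℝ) := by
    filter_upwards [hnat] with ω hω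
    obtain ⟨n, hn⟩ := hω t
    obtain ⟨l, hl⟩ := hω s
    have hle : l ≤ n := by
      have := measure_mono (μ := M ω) (hB hst)
      rw [hn, hl] at this
      exact_mod_cast this
    rw [measure_sdiff (hB hst) (hBm s).nullMeasurableSet (by simp [hl]), hn, hl,
      ENNReal.toReal_sub_of_le (by exact_mod_cast hle) (by simp)]
    simp
  refine ⟨fun t ↦ ?_, ?_, ?_, ?_, ?_, fun s t hst ↦ ?_⟩
  · exact Nat.measurable_floor.comp (hM.measurable_apply (hBm t)).ennreal_toReal
  · filter_upwards [hM.ae_eq_zero (hBm 0) (by simp [hΛ])] with ω hω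
    simp [hω]
  · filter_upwards [hnat] with ω hω s t hst
    obtain ⟨n, hn⟩ := hω t
    exact Nat.floor_mono (ENNReal.toReal_mono (by simp [hn]) (measure_mono (hB hst)))
  · filter_upwards [hev] with ω hω u
    obtain ⟨n, hn⟩ := hω u
    refine (tendsto_const_nhds (x := n)).congr' ?_ |>.mono_right ?_
    · filter_upwards [hn] with v hv
      simp [hv]
    · simp [hn.self_of_nhdsWithin Set.self_mem_Ici]
  · intro n t ht
    have hI := (hM.indep n (fun i ↦ B (t i.succ) \ B (t i.castSucc))
      (fun i ↦ (hBm _).diff (hBm _)) ?_).comp (fun _ ↦ ENNReal.toReal)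
      (fun _ ↦ ENNReal.measurable_toReal)
    · exact hI.congr fun i ↦ hsub _ _ (ht (Fin.castSucc_le_succ i))
    · have key (i j : Fin n) (hij : i < j) : Disjoint (B (t i.succ) \ B (t i.castSucc))
          (B (t j.succ) \ B (t j.castSucc)) :=
        Set.disjoint_left.2 fun x hx hx' ↦
          hx'.2 (hB (ht (Fin.succ_le_castSucc_iff.2 hij)) hx.1)
      intro i j hij
      rcases lt_or_gt_of_ne hij with h | h
      · exact key i j h
      · exact (key j i h).symm
  · have hd : Λ (B t \ B s) = (r * (t - s) : ℝ≥0) := by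
      rw [measure_sdiff (hB hst) (hBm s).nullMeasurableSet (hfin s).ne, hΛ, hΛ, mul_tsub,
        ENNReal.coe_sub]
    have h := hM.hasLaw_toReal ((hBm t).diff (hBm s)) (hd ▸ ENNReal.coe_lt_top)
    rw [hd, ENNReal.toNNReal_coe] at h
    exact h.congr ((hsub s t hst).mono fun ω h ↦ h.symm)

end

/-! ### Geometry of the pinned configurations -/

open Filter Topology Pointwise

/-- The configurations `𝐲` such that `h_t^±(0, 𝐲) = 1`. -/
def pinnedSet (d k : ℕ) (s : PM) (t : ℝ) : Set (Fin (k + 1) → EuclideanSpace ℝ (Fin d)) :=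
  {y | Matrix.vecCons 0 y ∈ hSet d k s t}

lemma h0_eq_indicator (d k : ℕ) (s : PM) (t : ℝ) :
    h0 d k s t = (pinnedSet d k s t).indicator 1 := by
  funext y
  rfl

/-- Along a convergent sequence of radii and centres, common points stay near the centre of index
`j₀ ∈ J`, hence are bounded; a subsequential limit is a common point for the limit data. Closedness
jointly in radius and centres yields both measurability and right-continuity in `t`. -/
lemma isClosed_setOf_nonempty_iInter_closedBall {ι F : Type*} [Finite ι] [NormedAddCommGroup F]
    [ProperSpace F] {J : Set ι} (hJ : J.Nonempty) :
    IsClosed {p : ℝ × (ι → F) | (⋂ j ∈ J, Metric.closedBall (p.2 j) p.1).Nonempty} := by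
  have := Fintype.ofFinite ι
  refine IsSeqClosed.isClosed fun p q hp hpq ↦ ?_
  obtain ⟨j₀, hj₀⟩ := hJ
  choose z hz using hp
  simp only [Set.mem_iInter, Metric.mem_closedBall] at hz
  have hr : Tendsto (fun n ↦ (p n).1) atTop (𝓝 q.1) := (continuous_fst.tendsto q).comp hpq
  have hx (j : ι) : Tendsto (fun n ↦ (p n).2 j) atTop (𝓝 (q.2 j)) :=
    (((continuous_apply j).comp continuous_snd).tendsto q).comp hpq
  obtain ⟨R, hR⟩ := (Metric.isBounded_range_of_tendsto _ hr).exists_norm_le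
  obtain ⟨S, hS⟩ := (Metric.isBounded_range_of_tendsto _ (hx j₀)).exists_norm_le
  have hbdd (n : ℕ) : z n ∈ Metric.closedBall (0 : F) (R + S) := by
    rw [mem_closedBall_zero_iff]
    have h1 := hR _ (Set.mem_range_self n)
    have h2 := hS _ (Set.mem_range_self n)
    have h3 := hz n j₀ hj₀
    rw [dist_eq_norm] at h3
    have h4 := norm_le_norm_sub_add (z n) ((p n).2 j₀)
    have h5 := Real.le_norm_self (p n).1
    linarith
  obtain ⟨a, -, θ, hθ, ha⟩ := tendsto_subseq_of_bounded Metric.isBounded_closedBall hbdd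
  refine ⟨a, ?_⟩
  simp only [Set.mem_iInter, Metric.mem_closedBall]
  intro j hj
  exact le_of_tendsto_of_tendsto' (ha.dist ((hx j).comp hθ.tendsto_atTop))
    (hr.comp hθ.tendsto_atTop) fun n ↦ hz _ j hj

variable {d k : ℕ}

lemma isClosed_setOf_mem_pinnedSet (s : PM) :
    IsClosed {p : ℝ × (Fin (k + 1) → EuclideanSpace ℝ (Fin d)) | p.2 ∈ pinnedSet d k s p.1} := by
  have hc : Continuous (fun p : ℝ × (Fin (k + 1) → EuclideanSpace ℝ (Fin d)) ↦
      (p.1, (Matrix.vecCons 0 p.2 : Fin (k + 2) → EuclideanSpace ℝ (Fin d)))) := by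
    fun_prop
  cases s with
  | plus =>
    have h (j₀ : Fin (k + 2)) := (isClosed_setOf_nonempty_iInter_closedBall
      (F := EuclideanSpace ℝ (Fin d)) (J := {j | j ≠ j₀}) (exists_ne j₀)).preimage hc
    convert isClosed_iInter h using 1
    ext p
    simp [pinnedSet, hSet]
  | minus =>
    have h := (isClosed_setOf_nonempty_iInter_closedBall
      (F := EuclideanSpace ℝ (Fin d)) (J := (Set.univ : Set (Fin (k + 2)))) ⟨0, trivial⟩).preimage hc
    convert h using 1
    ext p
    simp [pinnedSet, hSet]

lemma isClosed_pinnedSet (s : PM) (t : ℝ) : IsClosed (pinnedSet d k s t) :=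
  (isClosed_setOf_mem_pinnedSet s).preimage (by fun_prop : Continuous fun y ↦ (t, y))

lemma pinnedSet_mono (s : PM) : Monotone (pinnedSet d k s) := by
  intro t u htu y hy
  cases s with
  | plus =>
    exact fun j₀ ↦ (hy j₀).mono
      (Set.iInter₂_mono fun j _ ↦ Metric.closedBall_subset_closedBall htu)
  | minus =>
    exact Set.Nonempty.mono (Set.iInter_mono fun j ↦ Metric.closedBall_subset_closedBall htu) hy

lemma mem_pinnedSet_of_forall_lt {s : PM} {t : ℝ} {y : Fin (k + 1) → EuclideanSpace ℝ (Fin d)}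
    (hy : ∀ u, t < u → y ∈ pinnedSet d k s u) : y ∈ pinnedSet d k s t := by
  have hc : IsClosed {u | y ∈ pinnedSet d k s u} :=
    (isClosed_setOf_mem_pinnedSet s).preimage (by fun_prop : Continuous fun u : ℝ ↦ (u, y))
  have : closure (Set.Ioi t) ⊆ {u | y ∈ pinnedSet d k s u} := hc.closure_subset_iff.2 hy
  rw [closure_Ioi] at this
  exact this Set.self_mem_Ici

lemma norm_le_of_mem_pinnedSet (hk : 1 ≤ k) {s : PM} {t : ℝ}
    {y : Fin (k + 1) → EuclideanSpace ℝ (Fin d)} (hy : y ∈ pinnedSet d k s t) (i : Fin (k + 1)) :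
    ‖y i‖ ≤ 2 * t := by
  obtain ⟨z, hz0, hzi⟩ : ∃ z : EuclideanSpace ℝ (Fin d), dist z 0 ≤ t ∧ dist z (y i) ≤ t := by
    cases s with
    | plus =>
      -- As `k + 2 ≥ 3`, a third index can be dropped, leaving the balls about `0` and `y i` to
      -- meet. For `k = 0` the sign `+` would impose no bound.
      obtain ⟨j, hj0, hji⟩ : ∃ j : Fin (k + 2), (0 : Fin (k + 2)) ≠ j ∧ i.succ ≠ j := by
        have hcard : ({0, i.succ} : Finset (Fin (k + 2))).card < 
            (Finset.univ : Finset (Fin (k + 2))).card := by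
          refine (Finset.card_le_two).trans_lt ?_
          simp; omega
        obtain ⟨j, -, hj⟩ := Finset.exists_mem_notMem_of_card_lt_card hcard
        simp only [Finset.mem_insert, Finset.mem_singleton, not_or] at hj
        exact ⟨j, Ne.symm hj.1, Ne.symm hj.2⟩
      obtain ⟨z, hz⟩ := hy j
      simp only [Set.mem_iInter, Metric.mem_closedBall] at hz
      exact ⟨z, by simpa using hz 0 hj0, by simpa using hz i.succ hji⟩
    | minus =>
      obtain ⟨z, hz⟩ := hy
      simp only [Set.mem_iInter, Metric.mem_closedBall] at hz
      exact ⟨z, by simpa using hz 0, by simpa using hz i.succ⟩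
  have := dist_triangle_left (y i) 0 z
  rw [dist_zero_right] at this
  linarith

lemma isCompact_pinnedSet (hk : 1 ≤ k) (s : PM) (t : ℝ) : IsCompact (pinnedSet d k s t) := by
  refine Metric.isCompact_of_isClosed_isBounded (isClosed_pinnedSet s t)
    ((Metric.isBounded_closedBall (x := 0) (r := |2 * t|)).subset fun y hy ↦ ?_)
  rw [mem_closedBall_zero_iff, pi_norm_le_iff_of_nonneg (abs_nonneg _)]
  exact fun i ↦ (norm_le_of_mem_pinnedSet hk hy i).trans (le_abs_self _)

lemma zero_mem_pinnedSet (s : PM) {t : ℝ} (ht : 0 ≤ t) : 0 ∈ pinnedSet d k s t := by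
  have h0 : (Matrix.vecCons 0 0 : Fin (k + 2) → EuclideanSpace ℝ (Fin d)) = 0 := by simp
  cases s with
  | plus =>
    intro j₀
    refine ⟨0, ?_⟩
    simp [h0, ht]
  | minus =>
    refine ⟨0, ?_⟩
    simp [h0, ht]

lemma nonempty_iInter_closedBall_smul {ι F : Type*} [NormedAddCommGroup F] [NormedSpace ℝ F]
    {c t : ℝ} (hc : 0 ≤ c) {x : ι → F} {J : Set ι}
    (h : (⋂ j ∈ J, Metric.closedBall (x j) t).Nonempty) :
    (⋂ j ∈ J, Metric.closedBall ((c • x) j) (c * t)).Nonempty := by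
  obtain ⟨z, hz⟩ := h
  refine ⟨c • z, ?_⟩
  simp only [Set.mem_iInter, Metric.mem_closedBall] at hz ⊢
  intro j hj
  rw [Pi.smul_apply, dist_smul₀, Real.norm_of_nonneg hc]
  exact mul_le_mul_of_nonneg_left (hz j hj) hc

/-- Dilation about `0` fixes the pinned centre, so it acts on the remaining centres and the radius
alone. -/
lemma smul_mem_pinnedSet {s : PM} {c t : ℝ} (hc : 0 ≤ c)
    {y : Fin (k + 1) → EuclideanSpace ℝ (Fin d)} (hy : y ∈ pinnedSet d k s t) :
    c • y ∈ pinnedSet d k s (c * t) := by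
  have hv : (Matrix.vecCons 0 (c • y) : Fin (k + 2) → EuclideanSpace ℝ (Fin d))
      = c • (Matrix.vecCons 0 y : Fin (k + 2) → EuclideanSpace ℝ (Fin d)) := by simp [Matrix.smul_cons]
  change Matrix.vecCons 0 (c • y) ∈ hSet d k s (c * t)
  rw [hv]
  cases s with
  | plus => exact fun j₀ ↦ nonempty_iInter_closedBall_smul (J := {j | j ≠ j₀}) hc (hy j₀)
  | minus =>
    have h := nonempty_iInter_closedBall_smul (J := Set.univ) (t := t) hc
      (x := (Matrix.vecCons 0 y : Fin (k + 2) → EuclideanSpace ℝ (Fin d)))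
      (by simpa [pinnedSet, hSet] using hy)
    simp only [Set.mem_univ, Set.iInter_true] at h
    exact h

lemma pinnedSet_eq_smul (hk : 1 ≤ k) (s : PM) {t : ℝ} (ht : 0 ≤ t) :
    pinnedSet d k s t = t • pinnedSet d k s 1 := by
  obtain rfl | ht' := ht.eq_or_lt
  -- At `t = 0` the norm bound collapses the set to `{0}`, so inverting the dilation is not needed.
  · rw [Set.zero_smul_set ⟨0, zero_mem_pinnedSet s zero_le_one⟩]
    refine Set.Subset.antisymm (fun y hy ↦ ?_) ?_
    · have h : y = 0 := by
        funext i
        simpa using norm_le_of_mem_pinnedSet hk hy i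
      exact h
    · rintro _ rfl
      exact zero_mem_pinnedSet s le_rfl
  · refine Set.Subset.antisymm (fun y hy ↦ ?_) ?_
    · refine (Set.mem_smul_set_iff_inv_smul_mem₀ ht'.ne' _ _).2 ?_
      simpa [ht'.ne'] using smul_mem_pinnedSet (inv_nonneg.2 ht) hy
    · rintro _ ⟨y, hy, rfl⟩
      simpa using smul_mem_pinnedSet ht hy

lemma volume_pinnedSet (hk : 1 ≤ k) (s : PM) (t : ℝ≥0) :
    volume (pinnedSet d k s t) = (t ^ (d * (k + 1)) : ℝ≥0) * volume (pinnedSet d k s 1) := by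
  rw [pinnedSet_eq_smul hk s t.coe_nonneg, Measure.addHaar_smul_of_nonneg _ t.coe_nonneg,
    Module.finrank_pi_fintype]
  simp [mul_comm, ← NNReal.coe_pow, ENNReal.ofReal_coe_nnreal]

lemma C_nonneg {α : ℝ} (hα : (d : ℝ) < α) : 0 ≤ C d k α := by
  have hd : (0 : ℝ) ≤ d := Nat.cast_nonneg d
  have hk : (0 : ℝ) ≤ k := Nat.cast_nonneg k
  refine div_nonneg measureReal_nonneg (mul_nonneg (Nat.cast_nonneg _) ?_)
  nlinarith

lemma integral_h0 (s : PM) (t : ℝ) (μ : Measure (Fin (k + 1) → EuclideanSpace ℝ (Fin d))) :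
    ∫ y, h0 d k s t y ∂μ = μ.real (pinnedSet d k s t) := by
  rw [h0_eq_indicator, integral_indicator_one (isClosed_pinnedSet s t).measurableSet]

lemma integrable_h0 (s : PM) (t : ℝ) {μ : Measure (Fin (k + 1) → EuclideanSpace ℝ (Fin d))}
    (hμ : μ (pinnedSet d k s t) ≠ ∞) : Integrable (h0 d k s t) μ := by
  rw [h0_eq_indicator, integrable_indicator_iff (isClosed_pinnedSet s t).measurableSet]
  exact integrableOn_const hμ

lemma intensity_nonneg {α : ℝ} (hα : (d : ℝ) < α) (s : PM) : 0 ≤ intensity d k α s := by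
  rw [intensity, integral_h0]
  exact mul_nonneg (C_nonneg hα) measureReal_nonneg

lemma smul_volume_pinnedSet (hk : 1 ≤ k) (α : ℝ) (s : PM) (t : ℝ≥0) (hα : (d : ℝ) < α) :
    (ENNReal.ofReal (C d k α) • (volume : Measure (Fin (k + 1) → EuclideanSpace ℝ (Fin d))))
      (pinnedSet d k s t) = ((intensity d k α s).toNNReal * t ^ (d * (k + 1)) : ℝ≥0) := by
  rw [Measure.smul_apply, smul_eq_mul, volume_pinnedSet hk, intensity, integral_h0,
    ENNReal.coe_mul, Measure.real, ← ENNReal.ofReal, ENNReal.ofReal_mul (C_nonneg hα),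
    ENNReal.ofReal_toReal (isCompact_pinnedSet hk s 1).measure_lt_top.ne]
  ring

end CechPoisson

/-! ### The time change and the law of `V` -/

open CechPoisson in
theorem propositionp (d k : ℕ) (hd : 1 ≤ d) (hk : 1 ≤ k) (α : ℝ) (hα : (d : ℝ) < α)
    {Ω : Type*} [MeasurableSpace Ω] (P : Measure Ω) [IsProbabilityMeasure P]
    (M : Ω → Measure (Fin (k + 1) → EuclideanSpace ℝ (Fin d)))
    (hM : CechPoisson.IsPoissonRandomMeasure M
      (ENNReal.ofReal (CechPoisson.C d k α) • volume) P)
    (s : CechPoisson.PM) :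
    -- the integrals that define the intensity and the process converge
    Integrable (CechPoisson.h0 d k s 1) volume ∧
    0 ≤ CechPoisson.intensity d k α s ∧
    (∀ᵐ ω ∂P, ∀ t : ℝ≥0, Integrable (CechPoisson.h0 d k s t) (M ω)) ∧
    -- a Poisson process with that intensity exists, and, for every such process,
    -- its time change has the law of the process `V`
    (∃ N : ℝ≥0 → Ω → ℕ, CechPoisson.IsPoissonProcess N
      (CechPoisson.intensity d k α s).toNNReal P) ∧
    (∀ (Ω' : Type*) [MeasurableSpace Ω'] (P' : Measure Ω') [IsProbabilityMeasure P']
      (N : ℝ≥0 → Ω' → ℕ),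
      CechPoisson.IsPoissonProcess N (CechPoisson.intensity d k α s).toNNReal P' →
      IdentDistrib (fun ω (t : ℝ≥0) ↦ CechPoisson.V d k s M t ω)
        (fun ω' (t : ℝ≥0) ↦ (N (t ^ (d * (k + 1))) ω' : ℝ)) P P') := by
  have hm : d * (k + 1) ≠ 0 := Nat.mul_ne_zero (by omega) (by omega)
  let τ : ℝ≥0 ≃o ℝ≥0 := NNReal.powOrderIso (d * (k + 1)) hm
  have hτpow (t : ℝ≥0) : τ t = t ^ (d * (k + 1)) := rfl
  -- Reindexing by `τ.symm` makes the intensity of `B u` linear in `u`.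
  let B : ℝ≥0 → Set (Fin (k + 1) → EuclideanSpace ℝ (Fin d)) := fun u ↦
    pinnedSet d k s (τ.symm u : ℝ≥0)
  have hBm (u) : MeasurableSet (B u) := (isClosed_pinnedSet s _).measurableSet
  have hB : Monotone B := fun u v huv ↦
    pinnedSet_mono s (NNReal.coe_le_coe.2 (τ.symm.monotone huv))
  have hBr (u x) (h : ∀ v, u < v → x ∈ B v) : x ∈ B u := by
    refine mem_pinnedSet_of_forall_lt fun t ht ↦ ?_
    lift t to ℝ≥0 using (NNReal.coe_nonneg _).trans ht.le
    simpa [B] using h (τ t) (τ.symm_apply_lt.1 (NNReal.coe_lt_coe.1 ht))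
  have hΛ (u) : (ENNReal.ofReal (C d k α) • volume) (B u)
      = ((intensity d k α s).toNNReal * u : ℝ≥0) := by
    rw [smul_volume_pinnedSet hk α s _ hα]
    have : τ.symm u ^ (d * (k + 1)) = u := by
      rw [← hτpow, τ.apply_symm_apply]
    rw [this]
  have hτ (t : ℝ≥0) : B (t ^ (d * (k + 1))) = pinnedSet d k s t := by
    have : τ.symm (t ^ (d * (k + 1))) = t := by
      rw [← hτpow, τ.symm_apply_apply]
    simp only [B, this]
  have hnat : ∀ᵐ ω ∂P, ∀ t : ℝ≥0, ∃ n : ℕ, M ω (pinnedSet d k s t) = n := by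
    filter_upwards [hM.ae_eventually_natCast hBm hB hBr
      (fun u ↦ by rw [hΛ]; exact ENNReal.coe_lt_top)] with ω hω t
    obtain ⟨n, hn⟩ := hω (t ^ (d * (k + 1)))
    exact ⟨n, hτ t ▸ hn.self_of_nhdsWithin Set.self_mem_Ici⟩
  have hN₀ := hM.isPoissonProcess hBm hB hBr hΛ
  refine ⟨integrable_h0 s 1 (isCompact_pinnedSet hk s 1).measure_lt_top.ne,
    intensity_nonneg hα s, ?_, ⟨_, hN₀⟩, fun Ω' _ P' _ N hN ↦ ?_⟩
  · filter_upwards [hnat] with ω hω t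
    obtain ⟨n, hn⟩ := hω t
    exact integrable_h0 s t (by simp [hn])
  · have hθ : Measurable (fun (f : ℝ≥0 → ℝ) (t : ℝ≥0) ↦ f (t ^ (d * (k + 1)))) :=
      measurable_pi_lambda _ fun t ↦ measurable_pi_apply _
    -- `V` agrees almost surely, at all times at once, with the time-changed counting process built
    -- from `M`; that process is then exchanged for `N`.
    refine IdentDistrib.trans (IdentDistrib.of_ae_eq ?_ ?_) ((hN₀.identDistrib hN).comp hθ)
    · refine (measurable_pi_lambda _ fun t ↦ ?_).aemeasurable
      simp only [V, integral_h0]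
      exact (hM.measurable_apply (isClosed_pinnedSet s _).measurableSet).ennreal_toReal
    · filter_upwards [hnat] with ω hω
      funext t
      obtain ⟨n, hn⟩ := hω t
      simp [V, integral_h0, Measure.real, hτ, hn]
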